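/- For an integer $n\ge 2$ and a real number $p\ge 1$, let $\Omega(n,p)$ be the set of real $n\times n$ matrices all of whose rows are unit vectors in $l_p^n$, and let $U(n,p)$ be the maximum of the permanent $\mathrm{per}(A)=\sum_{\sigma\in S_n}\prod_{i=1}^n a_{i\sigma(i)}$ over $A\in\Omega(n,p)$. A matrix in $\Omega(n,p)$ is called optimal for $p$ if its permanent equals $U(n,p)$. Let $$p_0=p_0(n)=\frac{n\log n-(n-1)\log(n-1)}{\log n}.$$ (1) If $1\le p\le p_0$, then the identity matrix is optimal for $p$, and $$U(n,p)=1=\max\left\{1,\frac{n!}{n^{n/p}}\right\}.$$ (2) If $p_0\le p\le 2$, then the maximum $U(n,p)$ is attained and $$\max\left\{1,\frac{n!}{n^{n/p}}\right\}\le U(n,p)\le B(n,p),\qquad B(n,p):=\exp\left\{\frac{p-1}{p}\,e^{1/(p-1)}\right\}\cdot\frac{n!}{n^{n/p}}.$$ Moreover, this bound is tight within the subexponential factor $\exp\{n/\log n\}$: for all $n\ge2$ and $p_0\le p\le 2$, $$B(n,p)\le \exp\left\{\frac{n}{\log n}\right\}\cdot\max\left\{1,\frac{n!}{n^{n/p}}\right\}.$$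 For $p$ bounded away from $1$ it is tight within a constant factor: for every $\varepsilon>0$ there is a constant $C>0$, depending only on $\varepsilon$, such that $B(n,p)\le C\cdot\max\{1,n!/n^{n/p}\}$ for all $n\ge 2$ and all $p$ with $p_0\le p\le 2$ and $p\ge 1+\varepsilon$. -/

import Mathlib

open scoped ENNReal Nat

noncomputable section

namespace LpPermanent

/-- The set `Ω(n, p)` of real `n × n` matrices all of whose rows are unit vectors
in `l_p^n` (the `l_p` norm is the norm of `PiLp p`). -/
def unitRowMatrices (n : ℕ) (p : ℝ≥0∞) : Set (Matrix (Fin n) (Fin n) ℝ) :=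
  {A | ∀ i, ‖(WithLp.toLp p (A i) : PiLp p fun _ : Fin n => ℝ)‖ = 1}

/-- `U(n, p)`: the maximal permanent of a matrix in `Ω(n, p)`. (The supremum is written here;
that it is attained is asserted wherever the value is used.) -/
def U (n : ℕ) (p : ℝ≥0∞) : ℝ :=
  sSup (Matrix.permanent '' unitRowMatrices n p)

/-- `A` is optimal for `p`: it lies in `Ω(n, p)` and has maximal permanent there. -/
def IsOptimal {n : ℕ} (p : ℝ≥0∞) (A : Matrix (Fin n) (Fin n) ℝ) : Prop :=
  A ∈ unitRowMatrices n p ∧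
    ∀ B ∈ unitRowMatrices n p, B.permanent ≤ A.permanent

/-- `p₀ = (n log n - (n - 1) log (n - 1)) / log n`, used for `n ≥ 2`. -/
def p₀ (n : ℕ) : ℝ :=
  ((n : ℝ) * Real.log n - ((n : ℝ) - 1) * Real.log ((n : ℝ) - 1)) / Real.log n

/-- `n! / n^(n/p)`, the permanent of the `n × n` matrix with all entries `n^(-1/p)`. -/
def permJ (n : ℕ) (p : ℝ) : ℝ :=
  (n ! : ℝ) / (n : ℝ) ^ ((n : ℝ) / p)

/-- The upper bound `exp {(p - 1)/p * e^(1/(p - 1))} * n! / n^(n/p)`. -/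
def upperBound (n : ℕ) (p : ℝ) : ℝ :=
  Real.exp ((p - 1) / p * Real.exp (1 / (p - 1))) * permJ n p

end LpPermanent

end

/-! Taking absolute values, let A have nonnegative entries. Draw a permutation σ with weight ∏ A i
(σ i), of total mass P = per A. Gibbs' inequality against the probability vectors (A i j ^ p)_j
turns log P into the entropy H(σ) minus at least (1/p) Σ H(σ i). So everything reduces to a
statement on random permutations, `ent_le_sum_ent_marg`: H(σ) ≤ (1/p) Σ H(σ i) + `logBound p n`.

This goes by induction on the number m of free positions: reveal σ i, apply induction to the
conditioned permutation, and sum over i. Each H(σ k | σ i) is bounded by the cross entropy against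
the law of σ k with the value σ i deleted. Since σ is a bijection, the resulting terms sum to an
expression in the law s of σ k alone (`sum_ent_marg_cond_le`). What remains is (p₀ m - 1) Σ -s log s
≤ Σ -(1 - s) log (1 - s) on the simplex (`mul_entropy_le`).

With L m = log (m! / m^(m/p)), each step costs max(0, L m - L (m - 1)). As p₀ is antitone, the
increments change sign at most once: the total is 0 for p ≤ p₀ n, and in general L n - L m for some
m, where -L m is at most the exponent in B(n, p). The lower bounds come from the identity and the
constant matrix. -/

namespace LpPermanent

open Real

/-! ### An entropy inequality on the simplex -/

/-- The function `-(1 - x) log (1 - x) + c x log x`. -/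
noncomputable def entropyGap (c x : ℝ) : ℝ := negMulLog (1 - x) - c * negMulLog x

lemma continuous_entropyGap (c : ℝ) : Continuous (entropyGap c) := by
  unfold entropyGap
  fun_prop

lemma entropyGap_zero (c : ℝ) : entropyGap c 0 = 0 := by simp [entropyGap]

lemma entropyGap_one (c : ℝ) : entropyGap c 1 = 0 := by simp [entropyGap]

/-- The derivative of `entropyGap c` on `(0, 1)`. -/
noncomputable def entropyGapDeriv (c x : ℝ) : ℝ := log (1 - x) + 1 + c * (log x + 1)

lemma hasDerivAt_entropyGap (c : ℝ) {x : ℝ} (h0 : 0 < x) (h1 : x < 1) :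
    HasDerivAt (entropyGap c) (entropyGapDeriv c x) x := by
  have h2 : HasDerivAt (fun y : ℝ => 1 - y) (-1) x := by
    simpa using (hasDerivAt_id x).const_sub 1
  have h3 := (hasDerivAt_negMulLog (x := 1 - x) (by linarith)).comp x h2
  have h4 := (hasDerivAt_negMulLog h0.ne').const_mul c
  refine (h3.sub h4).congr_deriv ?_
  simp only [entropyGapDeriv]
  ring

lemma hasDerivAt_entropyGapDeriv (c : ℝ) {x : ℝ} (h0 : 0 < x) (h1 : x < 1) :
    HasDerivAt (entropyGapDeriv c) (-(1 - x)⁻¹ + c * x⁻¹) x := by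
  have h2 : HasDerivAt (fun y : ℝ => 1 - y) (-1) x := by
    simpa using (hasDerivAt_id x).const_sub 1
  have h3 := (hasDerivAt_log (x := 1 - x) (by linarith)).comp x h2
  have h4 := ((hasDerivAt_log h0.ne').add_const 1).const_mul c
  refine ((h3.add_const 1).add h4).congr_deriv ?_
  ring

lemma convexOn_entropyGap {c : ℝ} (hc : 0 < c) :
    ConvexOn ℝ (Set.Icc 0 (c / (1 + c))) (entropyGap c) := by
  have ha : c / (1 + c) < 1 := by rw [div_lt_one (by linarith)]; linarith
  refine convexOn_of_hasDerivWithinAt2_nonneg (convex_Icc _ _)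
    (continuous_entropyGap c).continuousOn (f' := entropyGapDeriv c)
    (f'' := fun x => -(1 - x)⁻¹ + c * x⁻¹) ?_ ?_ ?_ <;>
    rw [interior_Icc] <;> rintro x ⟨h0, h1⟩
  · exact (hasDerivAt_entropyGap c h0 (h1.trans ha)).hasDerivWithinAt
  · exact (hasDerivAt_entropyGapDeriv c h0 (h1.trans ha)).hasDerivWithinAt
  · have h2 : 0 < 1 - x := by linarith
    have h3 : x * (1 + c) ≤ c := ((lt_div_iff₀ (by linarith)).1 h1).le
    have : -(1 - x)⁻¹ + c * x⁻¹ = (c - x * (1 + c)) / (x * (1 - x)) := by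
      field_simp
      ring
    rw [this]
    exact div_nonneg (by linarith) (by positivity)

lemma strictConcaveOn_entropyGap {c : ℝ} (hc : 0 < c) :
    StrictConcaveOn ℝ (Set.Icc (c / (1 + c)) 1) (entropyGap c) := by
  have ha : 0 < c / (1 + c) := by positivity
  refine strictConcaveOn_of_deriv2_neg (convex_Icc _ _) (continuous_entropyGap c).continuousOn ?_
  rw [interior_Icc]
  rintro x ⟨h0, h1⟩
  have h0' : 0 < x := ha.trans h0
  have hd : deriv (entropyGap c) =ᶠ[nhds x] entropyGapDeriv c := by
    filter_upwards [Ioo_mem_nhds h0' h1] with y hy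
    exact (hasDerivAt_entropyGap c hy.1 hy.2).deriv
  rw [Function.iterate_succ, Function.iterate_one, Function.comp_apply, hd.deriv_eq,
    (hasDerivAt_entropyGapDeriv c h0' h1).deriv]
  have h2 : 0 < 1 - x := by linarith
  have h3 : c < x * (1 + c) := (div_lt_iff₀ (by linarith)).1 h0
  have : -(1 - x)⁻¹ + c * x⁻¹ = (c - x * (1 + c)) / (x * (1 - x)) := by
    field_simp
    ring
  rw [this]
  exact div_neg_of_neg_of_pos (by linarith) (by positivity)

/-- The sum of `entropyGap c` over a probability vector with one entry `x` and `N` further entries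
that are all equal. -/
noncomputable def spikeGap (c N x : ℝ) : ℝ := entropyGap c x + N * entropyGap c ((1 - x) / N)

lemma continuous_spikeGap (c N : ℝ) : Continuous (spikeGap c N) := by
  have := continuous_entropyGap c
  unfold spikeGap
  fun_prop

lemma hasDerivAt_spikeGap (c : ℝ) {N x : ℝ} (hN : 1 ≤ N) (h0 : 0 < x) (h1 : x < 1) :
    HasDerivAt (spikeGap c N) (entropyGapDeriv c x - entropyGapDeriv c ((1 - x) / N)) x := by
  have hN0 : 0 < N := by linarith
  have h2 : HasDerivAt (fun y : ℝ => (1 - y) / N) (-1 / N) x :=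
    ((hasDerivAt_id x).const_sub 1).div_const N
  have hy0 : 0 < (1 - x) / N := div_pos (by linarith) hN0
  have hy1 : (1 - x) / N < 1 := by rw [div_lt_one hN0]; linarith
  have h3 := ((hasDerivAt_entropyGap c hy0 hy1).comp x h2).const_mul N
  refine ((hasDerivAt_entropyGap c h0 h1).add h3).congr_deriv ?_
  field_simp
  ring

/-- The numerator is affine in x, so `spikeGap` changes convexity at most once. -/
lemma hasDerivAt_spikeGap_deriv (c : ℝ) {N x : ℝ} (hN : 1 ≤ N) (h0 : 0 < x) (h1 : x < 1) :
    HasDerivAt (fun x => entropyGapDeriv c x - entropyGapDeriv c ((1 - x) / N))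
      ((c * (N - 1) - x * (N - c)) / (x * (1 - x) * (N - 1 + x))) x := by
  have hN0 : 0 < N := by linarith
  have h2 : HasDerivAt (fun y : ℝ => (1 - y) / N) (-1 / N) x :=
    ((hasDerivAt_id x).const_sub 1).div_const N
  have hy0 : 0 < (1 - x) / N := div_pos (by linarith) hN0
  have hy1 : (1 - x) / N < 1 := by rw [div_lt_one hN0]; linarith
  have h3 := (hasDerivAt_entropyGapDeriv c hy0 hy1).comp x h2
  refine ((hasDerivAt_entropyGapDeriv c h0 h1).sub h3).congr_deriv ?_
  have h4 : 0 < 1 - x := by linarith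
  have h5 : 0 < N - 1 + x := by linarith
  have h6 : (1 - (1 - x) / N)⁻¹ = N / (N - 1 + x) := by
    rw [show 1 - (1 - x) / N = (N - 1 + x) / N by field_simp; ring, inv_div]
  rw [h6]
  field_simp
  ring

/-- At the uniform point t = 1/(N + 1) both the value and the slope vanish, and the value vanishes
again at 1. On [t, 1] the function is convex and then concave: it increases on the convex part, and
on the concave part it lies above the smaller of its end values. -/
lemma spikeGap_nonneg {c N : ℝ} (hN : 1 ≤ N) (hc1 : c ≤ 1)
    (hz : entropyGap c (1 / (N + 1)) = 0) {x : ℝ} (hx : 1 / (N + 1) ≤ x) (hx1 : x ≤ 1) :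
    0 ≤ spikeGap c N x := by
  have hN0 : 0 < N := by linarith
  set t : ℝ := 1 / (N + 1) with ht
  have ht0 : 0 < t := by positivity
  have ht1 : t < 1 := by rw [ht, div_lt_one (by linarith)]; linarith
  have hyt : (1 - t) / N = t := by rw [ht]; field_simp; ring
  have hK1 : spikeGap c N 1 = 0 := by simp [spikeGap, entropyGap_zero, entropyGap_one]
  have hKt : spikeGap c N t = 0 := by simp [spikeGap, hyt, hz]
  have hNc : 0 ≤ N - c := by linarith
  have concave : ∀ b, t ≤ b → b ≤ 1 → c * (N - 1) ≤ b * (N - c) → 0 ≤ spikeGap c N b →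
      ∀ x, b ≤ x → x ≤ 1 → 0 ≤ spikeGap c N x := by
    intro b hb hb1 hbc hKb x hx hx1
    have hcon : ConcaveOn ℝ (Set.Icc b 1) (spikeGap c N) := by
      refine concaveOn_of_hasDerivWithinAt2_nonpos (convex_Icc _ _)
        (continuous_spikeGap c N).continuousOn
        (f' := fun x => entropyGapDeriv c x - entropyGapDeriv c ((1 - x) / N))
        (f'' := fun x => (c * (N - 1) - x * (N - c)) / (x * (1 - x) * (N - 1 + x))) ?_ ?_ ?_ <;>
        rw [interior_Icc] <;> rintro y ⟨h0, h1⟩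
      · exact (hasDerivAt_spikeGap c hN (by linarith) h1).hasDerivWithinAt
      · exact (hasDerivAt_spikeGap_deriv c hN (by linarith) h1).hasDerivWithinAt
      · refine div_nonpos_of_nonpos_of_nonneg ?_ ?_
        · nlinarith
        · exact mul_nonneg (mul_nonneg (by linarith) (by linarith)) (by linarith)
    have := hcon.min_le_of_mem_Icc (x := b) (y := 1) (z := x) ⟨le_rfl, hb1⟩ ⟨hb1, le_rfl⟩ ⟨hx, hx1⟩
    rw [hK1, min_eq_right hKb] at this
    exact this
  rcases le_or_gt (c * (N - 1)) (t * (N - c)) with h | h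
  · exact concave t le_rfl ht1.le h hKt.ge x hx hx1
  -- N = c would force N = c = 1, and `h` would read 0 < 0.
  have hNc' : 0 < N - c := by
    rcases hNc.lt_or_eq with h' | h'
    · exact h'
    · exfalso
      have h2 : N = 1 := by linarith
      rw [← h', h2] at h
      linarith
  -- The inflection point, where the numerator of the second derivative vanishes.
  set b : ℝ := c * (N - 1) / (N - c) with hb
  have htb : t < b := by rw [hb, lt_div_iff₀ hNc']; exact h
  have hb1 : b ≤ 1 := by rw [hb, div_le_one hNc']; nlinarith
  have hbc : b * (N - c) = c * (N - 1) := by rw [hb]; field_simp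
  have deriv_nonneg : ∀ y, t ≤ y → y < b →
      0 ≤ entropyGapDeriv c y - entropyGapDeriv c ((1 - y) / N) := by
    have hm : MonotoneOn (fun x => entropyGapDeriv c x - entropyGapDeriv c ((1 - x) / N))
        (Set.Ico t b) := by
      refine monotoneOn_of_deriv_nonneg (convex_Ico _ _) ?_ ?_ ?_
      · intro y hy
        exact (hasDerivAt_spikeGap_deriv c hN (by linarith [hy.1])
          (by linarith [hy.2])).continuousAt.continuousWithinAt
      · rw [interior_Ico]
        intro y hy
        exact (hasDerivAt_spikeGap_deriv c hN (by linarith [hy.1])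
          (by linarith [hy.2])).differentiableAt.differentiableWithinAt
      · rw [interior_Ico]
        rintro y ⟨hy0, hy1⟩
        rw [(hasDerivAt_spikeGap_deriv c hN (by linarith) (by linarith)).deriv]
        refine div_nonneg ?_ ?_
        · nlinarith
        · exact mul_nonneg (mul_nonneg (by linarith) (by linarith)) (by linarith)
    intro y hy hyb
    have := hm ⟨le_rfl, htb⟩ ⟨hy, hyb⟩ hy
    simpa [hyt] using this
  have below : ∀ y, t ≤ y → y ≤ b → 0 ≤ spikeGap c N y := by
    intro y hy hyb
    have hm : MonotoneOn (spikeGap c N) (Set.Icc t b) := by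
      refine monotoneOn_of_deriv_nonneg (convex_Icc _ _) (continuous_spikeGap c N).continuousOn ?_ ?_
      · rw [interior_Icc]
        intro y hy
        exact (hasDerivAt_spikeGap c hN (by linarith [hy.1])
          (by linarith [hy.2])).differentiableAt.differentiableWithinAt
      · rw [interior_Icc]
        rintro y ⟨hy0, hy1⟩
        rw [(hasDerivAt_spikeGap c hN (by linarith) (by linarith)).deriv]
        exact deriv_nonneg y hy0.le hy1
    have := hm ⟨le_rfl, htb.le⟩ ⟨hy, hyb⟩ hy
    rwa [hKt] at this
  rcases le_total x b with h' | h'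
  · exact below x hx h'
  · exact concave b htb.le hb1 hbc.ge (below b htb.le le_rfl) x h' hx1

/-- Among the probability vectors, the sum of `entropyGap c` is nonnegative as soon as it vanishes
at the uniform vector. -/
lemma sum_entropyGap_nonneg {ι : Type*} [Fintype ι] {c : ℝ} (hc : 0 < c)
    (hc1 : c ≤ 1) (hcard : 2 ≤ Fintype.card ι) (hz : entropyGap c (1 / (Fintype.card ι : ℝ)) = 0)
    {s : ι → ℝ} (hs : s ∈ stdSimplex ℝ ι) : 0 ≤ ∑ j, entropyGap c (s j) := by
  classical
  have hcont : Continuous fun s : ι → ℝ => ∑ j, entropyGap c (s j) := by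
    have := continuous_entropyGap c
    fun_prop
  obtain ⟨v, hv, hmin⟩ := (isCompact_stdSimplex ℝ ι).exists_isMinOn ⟨s, hs⟩ hcont.continuousOn
  suffices h : 0 ≤ ∑ j, entropyGap c (v j) from h.trans (hmin hs)
  have : Nonempty ι := Fintype.card_pos_iff.1 (by omega)
  obtain ⟨i, hi⟩ := Finite.exists_max v
  set a : ℝ := c / (1 + c) with ha
  have ha0 : 0 < a := by positivity
  -- At a minimizer at most one coordinate lies in the region of strict concavity: with two, moving
  -- mass e either way between them would lower the sum. The choice e = v j - a keeps both
  -- coordinates in [a, 1].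
  have hother : ∀ j, j ≠ i → v j ≤ a := by
    intro j hj
    by_contra! hlt
    have hji := hi j
    have hsum : v i + v j ≤ 1 := by
      rw [← hv.2, ← Finset.sum_pair hj.symm]
      exact Finset.sum_le_univ_sum_of_nonneg hv.1
    set e : ℝ := v j - a with he
    have he0 : 0 < e := by linarith
    have hpert : ∀ d, |d| ≤ e → entropyGap c (v i) + entropyGap c (v j) ≤
        entropyGap c (v i + d) + entropyGap c (v j - d) := by
      intro d hd
      obtain ⟨hd1, hd2⟩ := abs_le.1 hd
      let w : ι → ℝ := Function.update (Function.update v i (v i + d)) j (v j - d)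
      have hwi : w i = v i + d := by simp [w, Function.update_of_ne hj.symm]
      have hwj : w j = v j - d := by simp [w]
      have hwk : ∀ k, k ≠ i → k ≠ j → w k = v k := by
        intro k h1 h2
        simp [w, h1, h2]
      have hsplit : ∀ f : ι → ℝ, ∑ k, f k = f i + f j + ∑ k ∈ Finset.univ \ {i, j}, f k := by
        intro f
        rw [← Finset.sum_pair hj.symm, add_comm, Finset.sum_sdiff (Finset.subset_univ _)]
      have hrest : ∀ f : ℝ → ℝ, ∑ k ∈ Finset.univ \ {i, j}, f (w k) =
          ∑ k ∈ Finset.univ \ {i, j}, f (v k) := by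
        intro f
        refine Finset.sum_congr rfl fun k hk => ?_
        simp only [Finset.mem_sdiff, Finset.mem_univ, Finset.mem_insert, Finset.mem_singleton,
          true_and, not_or] at hk
        rw [hwk k hk.1 hk.2]
      have hw : w ∈ stdSimplex ℝ ι := by
        refine ⟨fun k => ?_, ?_⟩
        · by_cases h1 : k = i
          · rw [h1, hwi]; linarith
          by_cases h2 : k = j
          · rw [h2, hwj]; linarith
          rw [hwk k h1 h2]
          exact hv.1 k
        · rw [hsplit, hwi, hwj, hrest (fun x => x), ← hv.2, hsplit v]
          ring
      have h3 : ∑ k, entropyGap c (v k) ≤ ∑ k, entropyGap c (w k) := hmin hw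
      rw [hsplit, hsplit fun k => entropyGap c (w k), hrest, hwi, hwj] at h3
      linarith
    have h1 := hpert e (by rw [abs_of_pos he0])
    have h2 := hpert (-e) (by rw [abs_neg, abs_of_pos he0])
    have hstrict : ∀ z, a < z → z - e ∈ Set.Icc a 1 → z + e ∈ Set.Icc a 1 →
        entropyGap c (z + e) + entropyGap c (z - e) < 2 * entropyGap c z := by
      intro z hz h3 h4
      have := (strictConcaveOn_entropyGap hc).2 h4 h3 (by linarith)
        (by norm_num : (0 : ℝ) < 1 / 2) (by norm_num : (0 : ℝ) < 1 / 2) (by norm_num)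
      simp only [smul_eq_mul] at this
      rw [show 1 / 2 * (z + e) + 1 / 2 * (z - e) = z by ring] at this
      linarith
    have h3 := hstrict (v i) (by linarith) ⟨by linarith, by linarith⟩ ⟨by linarith, by linarith⟩
    have h4 := hstrict (v j) hlt ⟨by linarith, by linarith⟩ ⟨by linarith, by linarith⟩
    simp only [← sub_eq_add_neg, sub_neg_eq_add] at h2
    linarith
  set N : ℝ := (Fintype.card ι : ℝ) - 1 with hN
  have hN1 : 1 ≤ N := by
    have : (2 : ℝ) ≤ Fintype.card ι := by exact_mod_cast hcard
    linarith
  have hN0 : 0 < N := by linarith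
  have hcardE : ((Finset.univ.erase i).card : ℝ) = N := by
    rw [Finset.card_erase_of_mem (Finset.mem_univ i), Finset.card_univ, Nat.cast_sub (by omega), hN,
      Nat.cast_one]
  have hsumE : ∑ j ∈ Finset.univ.erase i, v j = 1 - v i := by
    rw [← hv.2, ← Finset.add_sum_erase _ _ (Finset.mem_univ i)]
    ring
  -- All coordinates but the largest lie in the convex region, so averaging them reduces the problem
  -- to `spikeGap`.
  have hjensen : N * entropyGap c ((1 - v i) / N) ≤ ∑ j ∈ Finset.univ.erase i, entropyGap c (v j) := by
    have := (convexOn_entropyGap hc).map_sum_le (t := Finset.univ.erase i) (w := fun _ => N⁻¹)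
      (p := v) (fun _ _ => by positivity)
      (by rw [Finset.sum_const, nsmul_eq_mul, hcardE, mul_inv_cancel₀ hN0.ne'])
      (fun j hj => ⟨hv.1 j, hother j (Finset.ne_of_mem_erase hj)⟩)
    simp only [smul_eq_mul, ← Finset.mul_sum, hsumE] at this
    rw [inv_mul_eq_div, inv_mul_eq_div, le_div_iff₀ hN0] at this
    linarith
  have hvi : 1 / (N + 1) ≤ v i := by
    have : 1 ≤ (N + 1) * v i := by
      calc 1 = ∑ j, v j := hv.2.symm
        _ ≤ ∑ _j : ι, v i := Finset.sum_le_sum fun j _ => hi j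
        _ = (N + 1) * v i := by simp [hN]
    rw [div_le_iff₀ (by linarith)]
    linarith
  have hvi1 : v i ≤ 1 := by
    rw [← hv.2]
    exact Finset.single_le_sum (fun j _ => hv.1 j) (Finset.mem_univ i)
  have := spikeGap_nonneg hN1 hc1 (by rw [hN, sub_add_cancel]; exact hz) hvi hvi1
  rw [← Finset.add_sum_erase _ _ (Finset.mem_univ i)]
  unfold spikeGap at this
  linarith

/-! ### The critical exponent p₀ -/

lemma p₀_sub_one {m : ℕ} (hm : 2 ≤ m) :
    p₀ m - 1 = ((m : ℝ) - 1) * (log m - log ((m : ℝ) - 1)) / log m := by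
  have h : 0 < log (m : ℝ) := log_pos (by exact_mod_cast hm)
  rw [p₀]
  field_simp
  ring

lemma one_lt_p₀ {m : ℕ} (hm : 2 ≤ m) : 1 < p₀ m := by
  have h2 : (2 : ℝ) ≤ m := by exact_mod_cast hm
  have h : 0 < log (m : ℝ) := log_pos (by linarith)
  have h3 : log ((m : ℝ) - 1) < log m := log_lt_log (by linarith) (by linarith)
  have := p₀_sub_one hm
  have h4 : 0 < ((m : ℝ) - 1) * (log m - log ((m : ℝ) - 1)) / log m :=
    div_pos (mul_pos (by linarith) (by linarith)) h
  linarith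

lemma log_sub_log_sub_one_le {x : ℝ} (hx : 1 < x) : log x - log (x - 1) ≤ 1 / (x - 1) := by
  have h0 : 0 < x - 1 := by linarith
  rw [← log_div (by linarith) h0.ne']
  refine (log_le_sub_one_of_pos (div_pos (by linarith) h0)).trans_eq ?_
  field_simp
  ring

lemma p₀_two : p₀ 2 = 2 := by
  rw [p₀]
  norm_num

lemma p₀_le_two {m : ℕ} (hm : 2 ≤ m) : p₀ m ≤ 2 := by
  rcases hm.eq_or_lt with rfl | h3
  · exact p₀_two.le
  have h3' : (3 : ℝ) ≤ m := by exact_mod_cast h3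
  have hlog : 1 ≤ log (m : ℝ) := by
    rw [le_log_iff_exp_le (by linarith)]
    linarith [exp_one_lt_d9]
  have h1 := log_sub_log_sub_one_le (x := m) (by linarith)
  have h2 : ((m : ℝ) - 1) * (log m - log ((m : ℝ) - 1)) ≤ 1 := by
    rw [le_div_iff₀ (by linarith)] at h1
    linarith
  have h4 : p₀ m - 1 ≤ 1 := by
    rw [p₀_sub_one hm, div_le_one (by linarith)]
    linarith
  linarith

lemma entropyGap_p₀ {m : ℕ} (hm : 2 ≤ m) : entropyGap (p₀ m - 1) (1 / (m : ℝ)) = 0 := by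
  have h2 : (2 : ℝ) ≤ m := by exact_mod_cast hm
  have h : 0 < log (m : ℝ) := log_pos (by linarith)
  have h1 : 1 - 1 / (m : ℝ) = ((m : ℝ) - 1) / m := by field_simp
  rw [entropyGap, p₀_sub_one hm, negMulLog, negMulLog, h1, log_div (by linarith) (by linarith),
    one_div, log_inv]
  field_simp
  ring

/-- The sum of the `-(1 - s j) log (1 - s j)` is at least `p₀ - 1` times the entropy of `s`, with
equality for the uniform vector. -/
lemma mul_entropy_le {ι : Type*} [Fintype ι] (hcard : 2 ≤ Fintype.card ι)
    {s : ι → ℝ} (hs : s ∈ stdSimplex ℝ ι) :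
    (p₀ (Fintype.card ι) - 1) * ∑ j, negMulLog (s j) ≤ ∑ j, negMulLog (1 - s j) := by
  have := sum_entropyGap_nonneg (by linarith [one_lt_p₀ hcard]) (by linarith [p₀_le_two hcard])
    hcard (entropyGap_p₀ hcard) hs
  simp only [entropyGap, Finset.sum_sub_distrib, ← Finset.mul_sum] at this
  linarith

/-- The uniform vector on m points, padded with a zero, is a test vector for the inequality on m + 1
points; on m points it gives equality. -/
lemma p₀_succ_le {m : ℕ} (hm : 2 ≤ m) : p₀ (m + 1) ≤ p₀ m := by
  have h2 : (2 : ℝ) ≤ m := by exact_mod_cast hm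
  have h : 0 < log (m : ℝ) := log_pos (by linarith)
  let s : Fin (m + 1) → ℝ := Fin.cons 0 fun _ => 1 / (m : ℝ)
  have hs : s ∈ stdSimplex ℝ (Fin (m + 1)) := by
    refine ⟨fun j => ?_, ?_⟩
    · refine Fin.cases ?_ (fun j => ?_) j <;> simp [s]
    · have : (m : ℝ) ≠ 0 := by linarith
      simp [s, Fin.sum_univ_succ, this]
  have h1 := mul_entropy_le (by simp; omega) hs
  simp only [Fintype.card_fin, Fin.sum_univ_succ, s, Fin.cons_zero, Fin.cons_succ,
    negMulLog_zero, sub_zero, negMulLog_one, zero_add, Finset.sum_const, Finset.card_univ,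
    nsmul_eq_mul] at h1
  have h3 := entropyGap_p₀ hm
  rw [entropyGap] at h3
  have h4 : negMulLog (1 / (m : ℝ)) = log m / m := by
    rw [negMulLog, one_div, log_inv]
    field_simp
  have h5 : (p₀ (m + 1) - 1) * log m ≤ (p₀ m - 1) * log m := by
    have h6 : negMulLog (1 - 1 / (m : ℝ)) = (p₀ m - 1) * negMulLog (1 / (m : ℝ)) := by linarith
    rw [h6, h4] at h1
    field_simp at h1
    nlinarith
  have := le_of_mul_le_mul_right h5 h
  linarith

lemma p₀_le_p₀ {k m : ℕ} (hk : 2 ≤ k) (hkm : k ≤ m) : p₀ m ≤ p₀ k := by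
  induction m, hkm using Nat.le_induction with
  | base => exact le_rfl
  | succ m hkm ih => exact (p₀_succ_le (hk.trans hkm)).trans ih

/-! ### The cost of one induction step -/

/-- The increment `L m - L (m - 1)` of `L m = log (m! / m ^ (m / p))`. -/
noncomputable def logPermIncr (p : ℝ) (m : ℕ) : ℝ :=
  log m - ((m : ℝ) * log m - ((m : ℝ) - 1) * log ((m : ℝ) - 1)) / p

lemma mul_logPermIncr {p : ℝ} (hp : 0 < p) {m : ℕ} (hm : 2 ≤ m) :
    p * logPermIncr p m = (p - p₀ m) * log m := by
  have h : 0 < log (m : ℝ) := log_pos (by exact_mod_cast hm)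
  rw [logPermIncr, p₀]
  field_simp

lemma logPermIncr_one (p : ℝ) : logPermIncr p 1 = 0 := by simp [logPermIncr]

lemma sum_negMulLog_le {ι : Type*} [Fintype ι] [Nonempty ι] {s : ι → ℝ} (hs : s ∈ stdSimplex ℝ ι) :
    ∑ j, negMulLog (s j) ≤ log (Fintype.card ι) := by
  have hc : (0 : ℝ) < Fintype.card ι := by exact_mod_cast Fintype.card_pos
  have := concaveOn_negMulLog.le_map_sum (t := Finset.univ) (w := fun _ => (Fintype.card ι : ℝ)⁻¹)
    (p := s) (fun _ _ => by positivity) (by simp [hc.ne']) (fun j _ => hs.1 j)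
  simp only [smul_eq_mul, ← Finset.mul_sum, hs.2, mul_one] at this
  rw [negMulLog, log_inv, neg_mul_neg] at this
  exact le_of_mul_le_mul_left this (by positivity)

/-- By `mul_entropy_le` the left side is at most (p - p₀) H(s). This is nonpositive for p ≤ p₀;
otherwise H(s) ≤ log m bounds it by (p - p₀) log m, which is p times the increment. A single point
is treated apart, where `p₀` is meaningless. -/
lemma entropy_step_simplex {ι : Type*} [Fintype ι] [Nonempty ι] {p : ℝ} (hp : 1 ≤ p)
    {s : ι → ℝ} (hs : s ∈ stdSimplex ℝ ι) :
    (p - 1) * ∑ j, negMulLog (s j) - ∑ j, negMulLog (1 - s j) ≤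
      p * max 0 (logPermIncr p (Fintype.card ι)) := by
  have hp0 : 0 < p := by linarith
  have hmax : 0 ≤ p * max 0 (logPermIncr p (Fintype.card ι)) :=
    mul_nonneg hp0.le (le_max_left _ _)
  have hle : ∀ j, s j ≤ 1 := fun j => by
    rw [← hs.2]
    exact Finset.single_le_sum (fun j _ => hs.1 j) (Finset.mem_univ j)
  rcases (Nat.succ_le_of_lt (Fintype.card_pos (α := ι))).eq_or_lt with h1 | h2
  · have hH := sum_negMulLog_le hs
    rw [← h1] at hH
    simp only [Nat.succ_eq_add_one, zero_add, Nat.cast_one, log_one] at hH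
    have hT : 0 ≤ ∑ j, negMulLog (1 - s j) := Finset.sum_nonneg fun j _ =>
      negMulLog_nonneg (by linarith [hle j]) (by linarith [hs.1 j])
    nlinarith
  · have hc : 2 ≤ Fintype.card ι := h2
    have hA := mul_entropy_le hc hs
    have hH := sum_negMulLog_le hs
    have hH0 : 0 ≤ ∑ j, negMulLog (s j) := Finset.sum_nonneg fun j _ =>
      negMulLog_nonneg (hs.1 j) (hle j)
    rcases le_total p (p₀ (Fintype.card ι)) with h | h
    · nlinarith
    · have h3 : p * logPermIncr p (Fintype.card ι) ≤ p * max 0 (logPermIncr p (Fintype.card ι)) :=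
        mul_le_mul_of_nonneg_left (le_max_right _ _) hp0.le
      rw [mul_logPermIncr hp0 hc] at h3
      nlinarith

/-- The entropy of a nonnegative vector, homogeneous of degree one. -/
noncomputable def ent {κ : Type*} [Fintype κ] (f : κ → ℝ) : ℝ :=
  ∑ x, negMulLog (f x) - negMulLog (∑ x, f x)

/-- The homogeneous form, for weights of total mass Q. Only a set C containing the support is
counted, since earlier conditioning has used up the other values. -/
lemma entropy_step {κ : Type*} [Fintype κ] {p : ℝ} (hp : 1 ≤ p) {r : κ → ℝ}
    (hr : ∀ j, 0 ≤ r j) {Q : ℝ} (hQ : ∑ j, r j = Q) (hQ0 : 0 < Q) {C : Finset κ}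
    (hC : ∀ j, j ∉ C → r j = 0) :
    (p - 1) * ent r - ∑ j, (negMulLog (Q - r j) + (Q - r j) * log Q) ≤
      p * (Q * max 0 (logPermIncr p C.card)) := by
  have hsumC : ∑ j ∈ C, r j = Q := by
    rw [← hQ]
    exact Finset.sum_subset (Finset.subset_univ C) fun j _ hj => hC j hj
  have hCne : C.Nonempty := by
    by_contra h
    rw [Finset.not_nonempty_iff_eq_empty] at h
    rw [h, Finset.sum_empty] at hsumC
    linarith
  have : Nonempty C := hCne.to_subtype
  let s : C → ℝ := fun j => r j / Q
  have hs : s ∈ stdSimplex ℝ C := by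
    refine ⟨fun j => div_nonneg (hr j) hQ0.le, ?_⟩
    rw [← Finset.sum_div, Finset.sum_coe_sort C r, hsumC, div_self hQ0.ne']
  have key := entropy_step_simplex hp hs
  rw [Fintype.card_coe] at key
  have hterm : ∀ x : ℝ, Q * negMulLog (x / Q) = negMulLog x + x * log Q := by
    intro x
    rcases eq_or_ne x 0 with rfl | hx
    · simp
    · rw [negMulLog, negMulLog, log_div hx hQ0.ne']
      field_simp
      ring
  have h1 : Q * ∑ j, negMulLog (s j) = ent r := by
    rw [Finset.mul_sum]
    simp only [s, hterm]
    rw [Finset.sum_coe_sort C fun j => negMulLog (r j) + r j * log Q, Finset.sum_add_distrib,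
      ← Finset.sum_mul, hsumC, ent, hQ, negMulLog,
      Finset.sum_subset (Finset.subset_univ C) fun j _ hj => by rw [hC j hj, negMulLog_zero]]
    ring
  have h2 : Q * ∑ j, negMulLog (1 - s j) = ∑ j, (negMulLog (Q - r j) + (Q - r j) * log Q) := by
    rw [Finset.mul_sum]
    have h3 : ∀ j, 1 - s j = (Q - r j) / Q := fun j => by
      simp only [s]
      field_simp
    simp only [h3, hterm]
    rw [Finset.sum_coe_sort C fun j => negMulLog (Q - r j) + (Q - r j) * log Q]
    refine Finset.sum_subset (Finset.subset_univ C) fun j _ hj => ?_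
    rw [hC j hj, sub_zero, negMulLog]
    ring
  have := mul_le_mul_of_nonneg_left key hQ0.le
  rw [mul_sub, h2, mul_left_comm, h1] at this
  linarith

/-- Gibbs' inequality: the entropy is at most the cross entropy. -/
lemma ent_le_cross_entropy {κ : Type*} [Fintype κ] {x y : κ → ℝ} (hx : ∀ j, 0 ≤ x j)
    (hy : ∀ j, 0 ≤ y j) (hxy : ∀ j, y j = 0 → x j = 0) :
    ent x ≤ ∑ j, x j * (log (∑ i, y i) - log (y j)) := by
  set X := ∑ i, x i with hX
  set Y := ∑ i, y i with hY
  have hX0 : 0 ≤ X := Finset.sum_nonneg fun j _ => hx j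
  have hterm : ∀ j, negMulLog (x j) + x j * log X - x j * (log Y - log (y j)) ≤
      X * (y j / Y) - x j := by
    intro j
    rcases (hx j).eq_or_lt with h | h
    · rw [← h]
      have : 0 ≤ Y := Finset.sum_nonneg fun j _ => hy j
      simp only [negMulLog_zero, zero_mul, add_zero, sub_zero]
      exact mul_nonneg hX0 (div_nonneg (hy j) this)
    · have hyj : 0 < y j := lt_of_le_of_ne (hy j) fun h0 => h.ne' (hxy j h0.symm)
      have hXp : 0 < X := h.trans_le (Finset.single_le_sum (fun j _ => hx j) (Finset.mem_univ j))
      have hYp : 0 < Y := hyj.trans_le (Finset.single_le_sum (fun j _ => hy j) (Finset.mem_univ j))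
      have h1 := log_le_sub_one_of_pos (x := X * y j / (Y * x j)) (by positivity)
      rw [log_div (by positivity) (by positivity), log_mul (by positivity) (by positivity),
        log_mul (by positivity) (by positivity)] at h1
      have h2 := mul_le_mul_of_nonneg_left h1 h.le
      have h3 : x j * (X * y j / (Y * x j) - 1) = X * (y j / Y) - x j := by field_simp
      rw [h3] at h2
      rw [negMulLog]
      linarith
  have hsum := Finset.sum_le_sum fun j (_ : j ∈ Finset.univ) => hterm j
  simp only [Finset.sum_sub_distrib, Finset.sum_add_distrib, ← Finset.sum_mul, ← Finset.mul_sum,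
    ← Finset.sum_div, ← hX, ← hY] at hsum
  have h1 : X * (Y / Y) ≤ X := mul_le_of_le_one_right hX0 (div_self_le_one Y)
  rw [ent, ← hX, negMulLog]
  linarith

/-! ### Entropy of weighted permutations -/

/-- The weights `q` restricted to the permutations that map `i` to `j`. -/
def cond {α : Type*} [DecidableEq α] (q : Equiv.Perm α → ℝ) (i j : α)
    (σ : Equiv.Perm α) : ℝ := if σ i = j then q σ else 0

lemma cond_nonneg {α : Type*} [DecidableEq α] {q : Equiv.Perm α → ℝ} (hq : ∀ σ, 0 ≤ q σ)
    (i j : α) (σ : Equiv.Perm α) :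
    0 ≤ cond q i j σ := by
  unfold cond
  split_ifs
  exacts [hq σ, le_rfl]

section Permutations

variable {α : Type*} [Fintype α] [DecidableEq α]

/-- The total weight of the permutations that map `i` to `j`. -/
def marg (q : Equiv.Perm α → ℝ) (i j : α) : ℝ := ∑ σ, cond q i j σ

lemma marg_nonneg {q : Equiv.Perm α → ℝ} (hq : ∀ σ, 0 ≤ q σ) (i j : α) : 0 ≤ marg q i j :=
  Finset.sum_nonneg fun σ _ => cond_nonneg hq i j σ

lemma sum_marg_mul (q : Equiv.Perm α → ℝ) (i : α) (f : α → ℝ) :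
    ∑ j, marg q i j * f j = ∑ σ, q σ * f (σ i) := by
  simp only [marg, Finset.sum_mul]
  rw [Finset.sum_comm]
  refine Finset.sum_congr rfl fun σ _ => ?_
  simp [cond]

lemma sum_marg (q : Equiv.Perm α → ℝ) (i : α) : ∑ j, marg q i j = ∑ σ, q σ := by
  simpa using sum_marg_mul q i fun _ => 1

lemma exists_of_marg_ne_zero {q : Equiv.Perm α → ℝ} {i j : α} (h : marg q i j ≠ 0) :
    ∃ σ : Equiv.Perm α, σ i = j ∧ q σ ≠ 0 := by
  obtain ⟨σ, -, hσ⟩ := Finset.exists_ne_zero_of_sum_ne_zero h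
  unfold cond at hσ
  split_ifs at hσ with h1
  exacts [⟨σ, h1, hσ⟩, absurd rfl hσ]

/-- The chain rule for the entropy. -/
lemma ent_chain (q : Equiv.Perm α → ℝ) (i : α) :
    ent q = ent (marg q i) + ∑ j, ent (cond q i j) := by
  have h : ∑ j, ∑ σ, negMulLog (cond q i j σ) = ∑ σ, negMulLog (q σ) := by
    rw [Finset.sum_comm]
    refine Finset.sum_congr rfl fun σ _ => ?_
    rw [Finset.sum_eq_single (σ i)]
    · simp [cond]
    · intro j _ hj
      simp [cond, hj.symm]
    · simp
  simp only [ent, sum_marg, Finset.sum_sub_distrib, h]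
  change _ = _ - _ + (_ - ∑ j, negMulLog (marg q i j))
  ring

/-- The entropies of `σ k` conditioned on the value of `σ i`, summed over the `i ∈ R` other than
`k`. -/
lemma sum_ent_marg_cond_le {q : Equiv.Perm α → ℝ} (hq : ∀ σ, 0 ≤ q σ) {R : Finset α}
    (hR : ∀ σ τ, q σ ≠ 0 → q τ ≠ 0 → ∀ i, i ∉ R → σ i = τ i) {k : α} (hk : k ∈ R)
    {Q : ℝ} (hQ : ∑ σ, q σ = Q) :
    ∑ i ∈ R.erase k, ∑ j, ent (marg (cond q i j) k) ≤
      ((R.card : ℝ) - 1) * ent (marg q k) -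
        ∑ j, (negMulLog (Q - marg q k j) + (Q - marg q k j) * log Q) := by
  set r := marg q k with hr
  have hr0 : ∀ j, 0 ≤ r j := marg_nonneg hq k
  have hrQ : ∑ j, r j = Q := by rw [← hQ, ← sum_marg q k]
  -- The comparison vector is r with the entry j removed, of mass Q - r j: given σ i = j,
  -- injectivity forbids σ k = j.
  have gibbs : ∀ i ∈ R.erase k, ∀ j, ent (marg (cond q i j) k) ≤
      ∑ σ, cond q i j σ * (log (Q - r j) - log (r (σ k))) := by
    intro i hi j
    have hik := Finset.ne_of_mem_erase hi
    have hY : ∑ j', (if j' = j then 0 else r j') = Q - r j := by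
      rw [← hrQ, ← Finset.add_sum_erase _ _ (Finset.mem_univ j),
        ← Finset.add_sum_erase _ r (Finset.mem_univ j), if_pos rfl,
        Finset.sum_congr rfl fun j' hj' => if_neg (Finset.ne_of_mem_erase hj')]
      ring
    have hsupp : ∀ j', (if j' = j then 0 else r j') = 0 → marg (cond q i j) k j' = 0 := by
      intro j' hj'
      by_contra hne
      obtain ⟨σ, hσ, hσq⟩ := exists_of_marg_ne_zero hne
      unfold cond at hσq
      split_ifs at hσq with h1
      · split_ifs at hj' with h2
        · exact hik (σ.injective (by rw [h1, hσ, h2]))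
        · have h3 : cond q k j' σ = 0 := by
            rw [hr, marg] at hj'
            exact (Finset.sum_eq_zero_iff_of_nonneg fun σ _ => cond_nonneg hq k j' σ).1 hj' σ
              (Finset.mem_univ σ)
          rw [cond, if_pos hσ] at h3
          exact hσq h3
      · exact hσq rfl
    have h := ent_le_cross_entropy (marg_nonneg (cond_nonneg hq i j) k)
      (fun j' => by split_ifs; exacts [le_rfl, hr0 j']) hsupp
    rw [hY] at h
    refine h.trans_eq ?_
    rw [← sum_marg_mul (cond q i j) k fun j' => log (Q - r j) - log (r j')]
    refine Finset.sum_congr rfl fun j' _ => ?_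
    split_ifs with h1
    · rw [hsupp j' (if_pos h1), zero_mul, zero_mul]
    · rfl
  have hi : ∀ i ∈ R.erase k, ∑ j, ent (marg (cond q i j) k) ≤
      ∑ σ, q σ * (log (Q - r (σ i)) - log (r (σ k))) := by
    intro i hi
    refine (Finset.sum_le_sum fun j _ => gibbs i hi j).trans_eq ?_
    rw [Finset.sum_comm]
    refine Finset.sum_congr rfl fun σ _ => ?_
    simp [cond]
  refine (Finset.sum_le_sum hi).trans_eq ?_
  rw [Finset.sum_comm]
  set g : α → ℝ := fun j => log (Q - r j) - log Q with hg
  have hcard : ((R.erase k).card : ℝ) = (R.card : ℝ) - 1 := by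
    rw [Finset.card_erase_of_mem hk, Nat.cast_sub (Finset.card_pos.2 ⟨k, hk⟩), Nat.cast_one]
  have hσ : ∀ σ, ∑ i ∈ R.erase k, q σ * (log (Q - r (σ i)) - log (r (σ k))) =
      q σ * (((R.card : ℝ) - 1) * (log Q - log (r (σ k))) + ∑ j, g j - g (σ k)) := by
    intro σ
    rcases eq_or_ne (q σ) 0 with h0 | h0
    · simp [h0]
    have h1 : ∑ i ∈ R.erase k, g (σ i) = ∑ j, g j - g (σ k) := by
      rw [← Equiv.sum_comp σ g, ← Finset.add_sum_erase _ _ (Finset.mem_univ k), add_sub_cancel_left]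
      -- Positions outside R may be added for free: their value is frozen, so σ k never takes it and
      -- g vanishes there.
      refine Finset.sum_subset (Finset.erase_subset_erase k (Finset.subset_univ R)) ?_
      intro i hi hiR
      have hik := Finset.ne_of_mem_erase hi
      have hiR' : i ∉ R := fun h => hiR (Finset.mem_erase.2 ⟨hik, h⟩)
      have hz : r (σ i) = 0 := by
        by_contra hne
        obtain ⟨τ, hτ, hτq⟩ := exists_of_marg_ne_zero hne
        rw [hR σ τ h0 hτq i hiR'] at hτ
        exact hik (τ.injective hτ).symm
      simp [hg, hz]
    rw [← Finset.mul_sum, add_sub_assoc, ← h1, ← hcard, ← nsmul_eq_mul, ← Finset.sum_const,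
      ← Finset.sum_add_distrib]
    congr 1
    refine Finset.sum_congr rfl fun i _ => ?_
    simp only [hg]
    ring
  rw [Finset.sum_congr rfl fun σ _ => hσ σ,
    ← sum_marg_mul q k fun j => ((R.card : ℝ) - 1) * (log Q - log (r j)) + ∑ j, g j - g j, ← hr]
  have e1 : ent r = ∑ j, r j * (log Q - log (r j)) := by
    simp only [ent, mul_sub, Finset.sum_sub_distrib, ← Finset.sum_mul, hrQ, negMulLog,
      Finset.sum_neg_distrib, neg_mul]
    ring
  have e2 : ∑ j, (negMulLog (Q - r j) + (Q - r j) * log Q) = ∑ j, r j * g j - Q * ∑ j, g j := by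
    rw [Finset.mul_sum, ← Finset.sum_sub_distrib]
    refine Finset.sum_congr rfl fun j _ => ?_
    simp only [hg, negMulLog]
    ring
  have e3 : Q * ∑ j, g j = ∑ j, r j * ∑ i, g i := by rw [← Finset.sum_mul, hrQ]
  rw [e1, e2, e3, Finset.mul_sum, ← Finset.sum_sub_distrib, ← Finset.sum_sub_distrib]
  refine Finset.sum_congr rfl fun j _ => ?_
  ring

/-- The bound on the logarithm of the permanent of an `m × m` matrix with unit rows. -/
noncomputable def logBound (p : ℝ) (m : ℕ) : ℝ := ∑ k ∈ Finset.range m, max 0 (logPermIncr p (k + 1))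

/-- The entropy of a random permutation, bounded by the entropies of its values. -/
theorem ent_le_sum_ent_marg {p : ℝ} (hp : 1 ≤ p) (m : ℕ) {R : Finset α} (hm : R.card = m)
    {q : Equiv.Perm α → ℝ} (hq : ∀ σ, 0 ≤ q σ)
    (hR : ∀ σ τ, q σ ≠ 0 → q τ ≠ 0 → ∀ i, i ∉ R → σ i = τ i) :
    ent q ≤ 1 / p * ∑ i ∈ R, ent (marg q i) + (∑ σ, q σ) * logBound p m := by
  have hp0 : 0 < p := by linarith
  by_cases hex : ∃ σ, q σ ≠ 0
  swap
  · push Not at hex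
    obtain rfl : q = 0 := funext hex
    simp [ent, marg, cond]
  obtain ⟨σ₀, hσ₀⟩ := hex
  have hσ₀' : 0 < q σ₀ := lt_of_le_of_ne (hq σ₀) hσ₀.symm
  set Q := ∑ σ, q σ with hQ
  have hQ0 : 0 < Q := hσ₀'.trans_le (Finset.single_le_sum (fun σ _ => hq σ) (Finset.mem_univ σ₀))
  induction m generalizing R q σ₀ with
  | zero =>
    obtain rfl := Finset.card_eq_zero.1 hm
    -- With no free position the weight sits on one permutation, so the entropy is zero.
    have hz : ∀ σ, σ ≠ σ₀ → q σ = 0 := by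
      intro σ hσ
      by_contra h
      exact hσ (Equiv.ext fun i => hR σ σ₀ h hσ₀ i (Finset.notMem_empty i))
    have h1 : ent q = 0 := by
      rw [ent, Finset.sum_eq_single σ₀ (fun σ _ h => by rw [hz σ h, negMulLog_zero]) (by simp),
        Finset.sum_eq_single σ₀ (fun σ _ h => hz σ h) (by simp), sub_self]
    simp [h1, logBound]
  | succ m ih =>
    have hcondR : ∀ i ∈ R, ∀ j σ τ, cond q i j σ ≠ 0 → cond q i j τ ≠ 0 →
        ∀ l, l ∉ R.erase i → σ l = τ l := by
      intro i hi j σ τ hσ hτ l hl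
      unfold cond at hσ hτ
      split_ifs at hσ hτ with h1 h2 h2
      · rcases eq_or_ne l i with rfl | hli
        · rw [h1, h2]
        · exact hR σ τ hσ hτ l fun h => hl (Finset.mem_erase.2 ⟨hli, h⟩)
      all_goals exact absurd rfl ‹_›
    have step1 : ∀ i ∈ R, ∀ j, ent (cond q i j) ≤
        1 / p * ∑ k ∈ R.erase i, ent (marg (cond q i j) k) + marg q i j * logBound p m := by
      intro i hi j
      have hcard : (R.erase i).card = m := by rw [Finset.card_erase_of_mem hi, hm]; rfl
      by_cases hex : ∃ σ, cond q i j σ ≠ 0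
      · obtain ⟨σ₁, hσ₁⟩ := hex
        have h1 : 0 < cond q i j σ₁ := lt_of_le_of_ne (cond_nonneg hq i j σ₁) hσ₁.symm
        exact ih hcard (cond_nonneg hq i j) (hcondR i hi j) σ₁ hσ₁ h1 rfl
          (h1.trans_le (Finset.single_le_sum (fun σ _ => cond_nonneg hq i j σ)
            (Finset.mem_univ σ₁)))
      · push Not at hex
        have h0 : cond q i j = 0 := funext hex
        have h2 : ∀ k, marg (0 : Equiv.Perm α → ℝ) k = 0 := fun k => by
          ext; simp [marg, cond]
        rw [marg, h0]
        simp [h2, ent]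
    -- Chain rule, then the induction hypothesis on each conditioned weight. Summing over i ∈ R and
    -- exchanging i and k collects the terms belonging to each k.
    have step2 : ∀ i ∈ R, ent q ≤ ent (marg q i) +
        (1 / p * ∑ k ∈ R.erase i, ∑ j, ent (marg (cond q i j) k) + Q * logBound p m) := by
      intro i hi
      rw [ent_chain q i, hQ, ← sum_marg q i, Finset.sum_comm, Finset.mul_sum, Finset.sum_mul,
        ← Finset.sum_add_distrib]
      gcongr with j
      exact step1 i hi j
    have step3 := Finset.sum_le_sum step2
    rw [Finset.sum_const, Finset.sum_add_distrib, Finset.sum_add_distrib, Finset.sum_const,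
      ← Finset.mul_sum, Finset.sum_comm' (t' := R) (s' := fun k => R.erase k)
        (by intro x y; simp only [Finset.mem_erase]; tauto), hm, nsmul_eq_mul, nsmul_eq_mul] at step3
    -- All permutations in the support agree off R, hence share the image of R; thus exactly m + 1
    -- values are available to σ k.
    have hC : ∀ k ∈ R, ∀ j, j ∉ R.image σ₀ → marg q k j = 0 := by
      intro k hk j hj
      by_contra hne
      obtain ⟨σ, rfl, hσ⟩ := exists_of_marg_ne_zero hne
      refine hj (Finset.mem_image.2 ⟨σ₀.symm (σ k), ?_, by simp⟩)
      by_contra hl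
      have := hR σ σ₀ hσ hσ₀ _ hl
      rw [Equiv.apply_symm_apply] at this
      rw [σ.injective this] at hl
      exact hl hk
    have step4 : ∀ k ∈ R, ent (marg q k) +
        1 / p * ∑ i ∈ R.erase k, ∑ j, ent (marg (cond q i j) k) ≤
        ((m + 1 : ℕ) : ℝ) * (1 / p * ent (marg q k)) + Q * max 0 (logPermIncr p (m + 1)) := by
      intro k hk
      have h1 := sum_ent_marg_cond_le hq hR hk hQ.symm
      have h2 := entropy_step hp (marg_nonneg hq k) ((sum_marg q k).trans hQ.symm) hQ0 (hC k hk)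
      rw [Finset.card_image_of_injective _ σ₀.injective, hm] at h2
      rw [hm] at h1
      have h3 : p * ent (marg q k) + ∑ i ∈ R.erase k, ∑ j, ent (marg (cond q i j) k) ≤
          ((m + 1 : ℕ) : ℝ) * ent (marg q k) + p * (Q * max 0 (logPermIncr p (m + 1))) := by
        linarith
      have h4 := mul_le_mul_of_nonneg_left h3 (by positivity : 0 ≤ 1 / p)
      have h5 : 1 / p * (p * ent (marg q k)) = ent (marg q k) := by field_simp
      have h6 : 1 / p * (p * (Q * max 0 (logPermIncr p (m + 1)))) =
        Q * max 0 (logPermIncr p (m + 1)) := by field_simp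
      rw [mul_add, mul_add, h5, h6] at h4
      linarith
    have step5 := Finset.sum_le_sum step4
    rw [Finset.sum_add_distrib, Finset.sum_add_distrib, Finset.sum_const, hm, nsmul_eq_mul,
      ← Finset.mul_sum, ← Finset.mul_sum, ← Finset.mul_sum] at step5
    have hW : logBound p (m + 1) = logBound p m + max 0 (logPermIncr p (m + 1)) :=
      Finset.sum_range_succ _ _
    have hm0 : (0 : ℝ) < ((m + 1 : ℕ) : ℝ) := by positivity
    refine le_of_mul_le_mul_left ?_ hm0
    rw [hW]
    linarith

end Permutations

/-! ### From entropy to the permanent -/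

/-- A nonnegative matrix whose rows are unit vectors in `l_p` has permanent at most
`exp (logBound p n)`. -/
theorem permanent_le_exp_logBound {p : ℝ} (hp : 1 ≤ p) {n : ℕ} {A : Matrix (Fin n) (Fin n) ℝ}
    (hA : ∀ i j, 0 ≤ A i j) (hrow : ∀ i, ∑ j, A i j ^ p = 1) :
    A.permanent ≤ exp (logBound p n) := by
  have hp0 : 0 < p := by linarith
  set q : Equiv.Perm (Fin n) → ℝ := fun σ => ∏ i, A i (σ i) with hqdef
  have hq : ∀ σ, 0 ≤ q σ := fun σ => Finset.prod_nonneg fun i _ => hA i _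
  have hper : ∑ σ, q σ = A.permanent := by
    rw [← Matrix.permanent_transpose]
    rfl
  set P := A.permanent
  rcases le_or_gt P 0 with hP | hP
  · exact hP.trans (exp_pos _).le
  have hent := ent_le_sum_ent_marg hp n (R := Finset.univ) (by simp) hq
    (fun _ _ _ _ i hi => absurd (Finset.mem_univ i) hi)
  have hlogq : ∑ σ, negMulLog (q σ) = -∑ i, ∑ j, marg q i j * log (A i j) := by
    rw [Finset.sum_congr rfl fun i _ => sum_marg_mul q i fun j => log (A i j), Finset.sum_comm,
      ← Finset.sum_neg_distrib]
    refine Finset.sum_congr rfl fun σ _ => ?_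
    rw [← Finset.mul_sum, negMulLog, neg_mul]
    rcases eq_or_ne (q σ) 0 with h0 | h0
    · simp [h0]
    · rw [hqdef, log_prod fun i hi => Finset.prod_ne_zero_iff.1 h0 i hi]
  -- Cross entropy against the vector A i j ^ p, whose sum is 1; this is where the row condition
  -- enters.
  have hgibbs : ∀ i, 1 / p * ent (marg q i) ≤ -∑ j, marg q i j * log (A i j) := by
    intro i
    have hzero : ∀ j, A i j = 0 → marg q i j = 0 := by
      intro j hj
      by_contra hne
      obtain ⟨σ, rfl, hσ⟩ := exists_of_marg_ne_zero hne
      exact hσ (Finset.prod_eq_zero (Finset.mem_univ i) hj)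
    have h := ent_le_cross_entropy (marg_nonneg hq i) (y := fun j => A i j ^ p)
      (fun j => rpow_nonneg (hA i j) p)
      (fun j hj => hzero j ((rpow_eq_zero (hA i j) hp0.ne').1 hj))
    have h2 : ∑ j, marg q i j * (log (∑ k, A i k ^ p) - log (A i j ^ p)) =
        p * -∑ j, marg q i j * log (A i j) := by
      rw [hrow, ← Finset.sum_neg_distrib, Finset.mul_sum]
      refine Finset.sum_congr rfl fun j _ => ?_
      rcases (hA i j).eq_or_lt with h0 | h0
      · rw [hzero j h0.symm]
        simp
      · rw [log_rpow h0, log_one]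
        ring
    rw [h2] at h
    rw [one_div, inv_mul_le_iff₀ hp0]
    exact h
  have hsum := Finset.sum_le_sum fun i (_ : i ∈ Finset.univ) => hgibbs i
  rw [← Finset.mul_sum, Finset.sum_neg_distrib, ← hlogq] at hsum
  rw [ent, hper, negMulLog] at hent
  have h3 : P * log P ≤ P * logBound p n := by linarith
  rw [← log_le_iff_le_exp hP]
  exact le_of_mul_le_mul_left h3 hP

/-! ### Summing the increments -/

lemma logPermIncr_nonpos_iff {p : ℝ} (hp : 0 < p) {m : ℕ} (hm : 2 ≤ m) :
    logPermIncr p m ≤ 0 ↔ p ≤ p₀ m := by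
  have h : 0 < log (m : ℝ) := log_pos (by exact_mod_cast hm)
  have h1 := mul_logPermIncr hp hm
  constructor <;> intro h2 <;> by_contra! h3
  · nlinarith [mul_pos (sub_pos.2 h3) h, mul_nonneg hp.le (neg_nonneg.2 h2)]
  · nlinarith [mul_pos hp h3, mul_nonneg (sub_nonneg.2 h2) h.le]

lemma logBound_eq_zero {p : ℝ} (hp : 0 < p) {n : ℕ} (hpn : p ≤ p₀ n) :
    logBound p n = 0 := by
  refine Finset.sum_eq_zero fun k hk => max_eq_left ?_
  have hkn := Finset.mem_range.1 hk
  rcases Nat.eq_zero_or_pos k with rfl | h0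
  · exact (logPermIncr_one p).le
  · exact (logPermIncr_nonpos_iff hp (by omega)).2 (hpn.trans (p₀_le_p₀ (by omega) (by omega)))

lemma permJ_pos (n : ℕ) (p : ℝ) : 0 < permJ n p := by
  rcases Nat.eq_zero_or_pos n with rfl | hn
  · simp [permJ]
  · have : (0 : ℝ) < n := by exact_mod_cast hn
    unfold permJ
    positivity

lemma log_permJ (n : ℕ) (p : ℝ) : log (permJ n p) = log (n ! : ℝ) - n / p * log n := by
  rcases Nat.eq_zero_or_pos n with rfl | hn
  · simp [permJ]
  · have h : (0 : ℝ) < n := by exact_mod_cast hn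
    rw [permJ, log_div (by positivity) (by positivity), log_rpow h]

lemma logPermIncr_succ (p : ℝ) (n : ℕ) :
    logPermIncr p (n + 1) = log (permJ (n + 1) p) - log (permJ n p) := by
  rw [log_permJ, log_permJ, logPermIncr, Nat.factorial_succ, Nat.cast_mul,
    log_mul (by positivity) (by positivity)]
  push_cast
  rw [add_sub_cancel_right]
  ring

/-- Because p₀ is antitone, a nonpositive increment has only nonpositive ones before it. The
positive ones form a final block and telescope; m is the index just before that block. -/
lemma exists_logBound_eq {p : ℝ} (hp : 0 < p) (n : ℕ) :
    ∃ m, logBound p n = log (permJ n p) - log (permJ m p) := by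
  induction n with
  | zero => exact ⟨0, by simp [logBound]⟩
  | succ n ih =>
    have hsucc : logBound p (n + 1) = logBound p n + max 0 (logPermIncr p (n + 1)) :=
      Finset.sum_range_succ _ _
    rcases le_or_gt (logPermIncr p (n + 1)) 0 with h | h
    · refine ⟨n + 1, ?_⟩
      rw [sub_self]
      rcases Nat.eq_zero_or_pos n with rfl | h0
      · simp [logBound, logPermIncr_one]
      · exact logBound_eq_zero hp ((logPermIncr_nonpos_iff hp (by omega)).1 h)
    · obtain ⟨m, hm⟩ := ih
      refine ⟨m, ?_⟩
      rw [hsucc, hm, max_eq_right h.le, logPermIncr_succ]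
      ring

/-- From m! ≥ (m/e)^m, -L m ≤ m - (1 - 1/p) m log m. The maximum of the right side over real m is
the stated bound, obtained from e^y ≥ 1 + y at y = 1/(p - 1) - log m. -/
lemma neg_log_permJ_le {p : ℝ} (hp : 1 < p) (m : ℕ) :
    -log (permJ m p) ≤ (p - 1) / p * exp (1 / (p - 1)) := by
  have hp1 : 0 < p - 1 := by linarith
  rcases Nat.eq_zero_or_pos m with rfl | hm
  · rw [log_permJ]
    simp only [Nat.factorial_zero, Nat.cast_one, log_one, CharP.cast_eq_zero, zero_div, zero_mul,
      sub_zero, neg_zero]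
    positivity
  have h : (0 : ℝ) < m := by exact_mod_cast hm
  have hfact : m * log m - m ≤ log (m ! : ℝ) := by
    have h1 := pow_div_factorial_le_exp (m : ℝ) h.le m
    have h2 := log_le_log (by positivity) h1
    rw [log_exp, log_div (by positivity) (by positivity), log_pow] at h2
    linarith
  have hexp : m * (1 / (p - 1) - log m + 1) ≤ exp (1 / (p - 1)) := by
    have h1 := mul_le_mul_of_nonneg_left (add_one_le_exp (1 / (p - 1) - log m)) h.le
    rwa [exp_sub, exp_log h, mul_div_cancel₀ _ h.ne'] at h1
  have h2 := mul_le_mul_of_nonneg_left hexp (by positivity : 0 ≤ (p - 1) / p)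
  have h3 : (p - 1) / p * (m * (1 / (p - 1) - log m + 1)) = m + m / p * log m - m * log m := by
    field_simp
    ring
  rw [log_permJ]
  linarith

lemma exp_logBound_le_upperBound {p : ℝ} (hp : 1 < p) (n : ℕ) :
    exp (logBound p n) ≤ upperBound n p := by
  obtain ⟨m, hm⟩ := exists_logBound_eq (p := p) (by linarith) n
  rw [upperBound, ← exp_log (permJ_pos n p), ← exp_add, hm, exp_le_exp]
  have := neg_log_permJ_le hp m
  linarith

/-! ### Matrices with unit rows and existence of a maximum -/

section UnitRows

variable {n : ℕ} {p : ℝ}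

lemma mem_unitRowMatrices_iff (hp : 1 ≤ p) {A : Matrix (Fin n) (Fin n) ℝ} :
    A ∈ unitRowMatrices n (ENNReal.ofReal p) ↔ ∀ i, ∑ j, |A i j| ^ p = 1 := by
  have hp0 : 0 < p := by linarith
  have hto : (ENNReal.ofReal p).toReal = p := ENNReal.toReal_ofReal hp0.le
  refine forall_congr' fun i => ?_
  rw [PiLp.norm_eq_sum (by rw [hto]; exact hp0), hto]
  simp only [Real.norm_eq_abs]
  have hS : 0 ≤ ∑ j, |A i j| ^ p := Finset.sum_nonneg fun j _ => by positivity
  constructor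
  · intro h
    have h1 := rpow_mul hS (1 / p) p
    rwa [one_div_mul_cancel hp0.ne', rpow_one, h, one_rpow] at h1
  · intro h
    rw [h, one_rpow]

lemma isCompact_unitRowMatrices (hp : 1 ≤ p) :
    IsCompact (unitRowMatrices n (ENNReal.ofReal p)) := by
  have hp0 : 0 < p := by linarith
  have hbox : IsCompact (Set.univ.pi fun _ : Fin n => Set.univ.pi fun _ : Fin n =>
      Set.Icc (-1 : ℝ) 1) :=
    isCompact_univ_pi fun _ => isCompact_univ_pi fun _ => isCompact_Icc
  refine hbox.of_isClosed_subset ?_ ?_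
  · have : unitRowMatrices n (ENNReal.ofReal p) =
        ⋂ i, {A : Matrix (Fin n) (Fin n) ℝ | ∑ j, |A i j| ^ p = 1} := by
      ext A
      simp [mem_unitRowMatrices_iff hp]
    rw [this]
    refine isClosed_iInter fun i => isClosed_eq ?_ continuous_const
    refine continuous_finsetSum _ fun j _ => ?_
    exact (continuous_id.matrix_elem i j).abs.rpow_const fun _ => Or.inr hp0.le
  · intro A hA i _ j _
    replace hA := (mem_unitRowMatrices_iff hp).1 hA
    have h1 : |A i j| ^ p ≤ 1 := by
      rw [← hA i]
      exact Finset.single_le_sum (f := fun j => |A i j| ^ p) (fun k _ => by positivity)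
        (Finset.mem_univ j)
    have h2 : |A i j| ≤ 1 := by
      by_contra! h
      exact h1.not_gt (one_lt_rpow h hp0)
    exact abs_le.1 h2

lemma one_mem_unitRowMatrices (hp : 1 ≤ p) :
    (1 : Matrix (Fin n) (Fin n) ℝ) ∈ unitRowMatrices n (ENNReal.ofReal p) := by
  rw [mem_unitRowMatrices_iff hp]
  intro i
  rw [Finset.sum_eq_single i]
  · simp
  · intro j _ hj
    rw [Matrix.one_apply_ne hj.symm, abs_zero, zero_rpow (by linarith)]
  · simp

lemma exists_permanent_eq_permJ (hn : 0 < n) (hp : 1 ≤ p) :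
    ∃ A ∈ unitRowMatrices n (ENNReal.ofReal p), A.permanent = permJ n p := by
  have h : (0 : ℝ) < n := by exact_mod_cast hn
  refine ⟨Matrix.of fun _ _ => (n : ℝ) ^ (-1 / p), ?_, ?_⟩
  · rw [mem_unitRowMatrices_iff hp]
    intro i
    have h1 : |(n : ℝ) ^ (-1 / p)| ^ p = (n : ℝ)⁻¹ := by
      rw [abs_of_nonneg (by positivity), ← rpow_mul h.le, div_mul_cancel₀ _ (by linarith),
        rpow_neg_one]
    simp [h1, h.ne']
  · have h1 : ((n : ℝ) ^ (-1 / p)) ^ n = ((n : ℝ) ^ ((n : ℝ) / p))⁻¹ := by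
      rw [← rpow_natCast, ← rpow_mul h.le, ← rpow_neg h.le]
      congr 1
      ring
    simp only [Matrix.permanent, Matrix.of_apply, Finset.prod_const, Finset.sum_const,
      Finset.card_univ, Fintype.card_perm, Fintype.card_fin, nsmul_eq_mul, h1, permJ,
      div_eq_mul_inv (n ! : ℝ)]

lemma permanent_le_of_mem (hp : 1 ≤ p) {A : Matrix (Fin n) (Fin n) ℝ}
    (hA : A ∈ unitRowMatrices n (ENNReal.ofReal p)) : A.permanent ≤ exp (logBound p n) := by
  rw [mem_unitRowMatrices_iff hp] at hA
  have h1 : A.permanent ≤ (Matrix.of fun i j => |A i j|).permanent := by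
    refine Finset.sum_le_sum fun σ _ => (le_abs_self _).trans_eq ?_
    simp [Finset.abs_prod]
  exact h1.trans (permanent_le_exp_logBound hp (fun _ _ => abs_nonneg _) hA)

lemma exists_isOptimal (hp : 1 ≤ p) :
    ∃ A : Matrix (Fin n) (Fin n) ℝ, IsOptimal (ENNReal.ofReal p) A := by
  have hcont : Continuous (Matrix.permanent : Matrix (Fin n) (Fin n) ℝ → ℝ) := by
    unfold Matrix.permanent
    exact continuous_finsetSum _ fun σ _ => continuous_finsetProd _ fun i _ =>
      continuous_id.matrix_elem _ _
  obtain ⟨A, hA, hmax⟩ := (isCompact_unitRowMatrices hp).exists_isMaxOn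
    ⟨1, one_mem_unitRowMatrices hp⟩ hcont.continuousOn
  exact ⟨A, hA, fun B hB => hmax hB⟩

lemma IsOptimal.permanent_eq {p : ℝ≥0∞} {A : Matrix (Fin n) (Fin n) ℝ} (hA : IsOptimal p A) :
    A.permanent = U n p := by
  have : IsGreatest (Matrix.permanent '' unitRowMatrices n p) A.permanent :=
    ⟨⟨A, hA.1, rfl⟩, by rintro _ ⟨B, hB, rfl⟩; exact hA.2 B hB⟩
  exact this.csSup_eq.symm

end UnitRows

/-! ### Size of the exponent -/

/-- From y ≤ sinh y at y = log √x, log x ≤ √x - 1/√x; then square. -/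
lemma log_mul_self_le {x : ℝ} (hx : 1 ≤ x) : log x * log x ≤ x - 1 := by
  have hx0 : 0 < x := by linarith
  have h0 : 0 ≤ log (√x) := log_nonneg (by rw [one_le_sqrt]; exact hx)
  have h1 := self_le_sinh_iff.2 h0
  have hs : 0 < √x := sqrt_pos.2 hx0
  rw [sinh_log hs] at h1
  have h2 : log x = 2 * log (√x) := by rw [log_sqrt hx0.le]; ring
  have h3 : log x ≤ √x - (√x)⁻¹ := by linarith
  have h4 : √x * √x = x := mul_self_sqrt hx0.le
  have h5 : √x * (√x)⁻¹ = 1 := mul_inv_cancel₀ hs.ne'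
  have h6 : (√x - (√x)⁻¹) * (√x - (√x)⁻¹) ≤ x - 1 := by
    nlinarith [mul_self_nonneg ((√x)⁻¹), inv_mul_le_one_of_le₀ hx hx0.le]
  exact (mul_self_le_mul_self (log_nonneg hx) h3).trans h6

lemma exp_div_one_add_mono {v w : ℝ} (hv : 0 < v) (hvw : v ≤ w) :
    exp v / (1 + v) ≤ exp w / (1 + w) := by
  rw [div_le_div_iff₀ (by linarith) (by linarith)]
  have h1 : exp w = exp v * exp (w - v) := by rw [← exp_add]; congr 1; ring
  have h2 := add_one_le_exp (w - v)
  have h3 := exp_pos v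
  rw [h1, mul_assoc]
  refine mul_le_mul_of_nonneg_left ?_ h3.le
  nlinarith

/-- With v = 1/(p - 1) the exponent is e^v / (1 + v), increasing in v, and p ≥ p₀ gives v ≤ log n +
d with d = log n / (n - 1). It remains to see e^d log n ≤ 1 + log n + d, which follows from e^d ≤ 1
+ d + d² and d log n ≤ 1. -/
lemma upperBound_exponent_le {n : ℕ} (hn : 2 ≤ n) {p : ℝ} (hp : p₀ n ≤ p) :
    (p - 1) / p * exp (1 / (p - 1)) ≤ n / log n := by
  have h2 : (2 : ℝ) ≤ n := by exact_mod_cast hn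
  have hl : 0 < log (n : ℝ) := log_pos (by linarith)
  have h1 := one_lt_p₀ hn
  have hp1 : 0 < p - 1 := by linarith
  set d : ℝ := log n / ((n : ℝ) - 1) with hd
  have hn1 : 0 < (n : ℝ) - 1 := by linarith
  have hd0 : 0 < d := by positivity
  have hlog1 : log (n : ℝ) ≤ n - 1 := log_le_sub_one_of_pos (by linarith)
  have hd1 : d ≤ 1 := by rw [hd, div_le_one hn1]; exact hlog1
  have hdl : d * log n ≤ 1 := by
    rw [hd, div_mul_eq_mul_div, div_le_one hn1]
    exact log_mul_self_le (by linarith)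
  have hv : 1 / (p - 1) ≤ log n + d := by
    have h3 : 1 / (n : ℝ) ≤ log n - log (n - 1) := by
      have := log_le_sub_one_of_pos (x := ((n : ℝ) - 1) / n) (by positivity)
      rw [log_div hn1.ne' (by linarith)] at this
      have h4 : ((n : ℝ) - 1) / n - 1 = -(1 / n) := by field_simp; ring
      linarith
    have h5 : ((n : ℝ) - 1) / (n * log n) ≤ p₀ n - 1 := by
      rw [p₀_sub_one hn, div_le_div_iff₀ (by positivity) hl]
      have h6 := mul_le_mul_of_nonneg_left h3 (by positivity : 0 ≤ ((n : ℝ) - 1) * log n * n)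
      have h7 : ((n : ℝ) - 1) * log n * n * (1 / n) = (n - 1) * log n := by field_simp
      linarith
    have h8 : 1 / (p - 1) ≤ 1 / (((n : ℝ) - 1) / (n * log n)) :=
      one_div_le_one_div_of_le (by positivity) (by linarith)
    refine h8.trans_eq ?_
    rw [hd]
    field_simp
    ring
  have h3 : (p - 1) / p * exp (1 / (p - 1)) = exp (1 / (p - 1)) / (1 + 1 / (p - 1)) := by
    have : p ≠ 0 := by linarith
    field_simp
    ring
  rw [h3]
  refine (exp_div_one_add_mono (by positivity) hv).trans ?_
  rw [exp_add, exp_log (by linarith), div_le_div_iff₀ (by positivity) hl, mul_assoc]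
  refine mul_le_mul_of_nonneg_left ?_ (by linarith)
  have hexp : exp d ≤ 1 + d + d * d := by
    have := abs_exp_sub_one_sub_id_le (x := d) (by rw [abs_of_pos hd0]; exact hd1)
    have := (abs_le.1 this).2
    nlinarith
  have h5 := mul_le_mul_of_nonneg_right hexp hl.le
  nlinarith

end LpPermanent

open LpPermanent

/-! ### The main theorem -/

theorem mainTheorem1 :
    -- for every fixed dimension
    (∀ n : ℕ, 2 ≤ n →
      -- part 1
      (∀ p : ℝ, 1 ≤ p → p ≤ LpPermanent.p₀ n →
        LpPermanent.IsOptimal (ENNReal.ofReal p) (1 : Matrix (Fin n) (Fin n) ℝ) ∧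
        LpPermanent.U n (ENNReal.ofReal p) = 1 ∧
        LpPermanent.U n (ENNReal.ofReal p) = max 1 (LpPermanent.permJ n p)) ∧
      -- part 2, with the worst-case tightness of the bound
      (∀ p : ℝ, LpPermanent.p₀ n ≤ p → p ≤ 2 →
        (∃ A : Matrix (Fin n) (Fin n) ℝ, LpPermanent.IsOptimal (ENNReal.ofReal p) A ∧
          A.permanent = LpPermanent.U n (ENNReal.ofReal p)) ∧
        max 1 (LpPermanent.permJ n p) ≤ LpPermanent.U n (ENNReal.ofReal p) ∧
        LpPermanent.U n (ENNReal.ofReal p) ≤ LpPermanent.upperBound n p ∧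
        LpPermanent.upperBound n p ≤
          Real.exp ((n : ℝ) / Real.log n) * max 1 (LpPermanent.permJ n p))) ∧
    -- for `p` bounded away from `1` the bound is tight within a constant factor
    (∀ ε : ℝ, 0 < ε → ∃ C : ℝ, 0 < C ∧ ∀ n : ℕ, 2 ≤ n →
      ∀ p : ℝ, LpPermanent.p₀ n ≤ p → 1 + ε ≤ p → p ≤ 2 →
        LpPermanent.upperBound n p ≤ C * max 1 (LpPermanent.permJ n p)) := by
  have hmax : ∀ n p, 0 ≤ max 1 (permJ n p) := fun n p => zero_le_one.trans (le_max_left _ _)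
  have hfactor : ∀ n p t, (p - 1) / p * Real.exp (1 / (p - 1)) ≤ t →
      upperBound n p ≤ Real.exp t * max 1 (permJ n p) := fun n p t h =>
    mul_le_mul (Real.exp_le_exp.2 h) (le_max_right _ _) (permJ_pos n p).le (Real.exp_pos _).le
  refine ⟨fun n hn => ⟨fun p hp hpn => ?_, fun p hpn hp2 => ?_⟩, fun ε hε => ?_⟩
  · have hle : ∀ B ∈ unitRowMatrices n (ENNReal.ofReal p), B.permanent ≤ 1 := by
      intro B hB
      have := permanent_le_of_mem hp hB
      rwa [logBound_eq_zero (by linarith) hpn, Real.exp_zero] at this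
    have hopt : IsOptimal (ENNReal.ofReal p) (1 : Matrix (Fin n) (Fin n) ℝ) :=
      ⟨one_mem_unitRowMatrices hp, fun B hB => by rw [Matrix.permanent_one]; exact hle B hB⟩
    have hU : U n (ENNReal.ofReal p) = 1 := by rw [← hopt.permanent_eq, Matrix.permanent_one]
    obtain ⟨J, hJ, hJper⟩ := exists_permanent_eq_permJ (n := n) (by omega) hp
    exact ⟨hopt, hU, by rw [hU, max_eq_left (hJper ▸ hle J hJ)]⟩
  · have hp1 : 1 < p := (one_lt_p₀ hn).trans_le hpn
    obtain ⟨A, hA⟩ := exists_isOptimal (n := n) hp1.le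
    obtain ⟨J, hJ, hJper⟩ := exists_permanent_eq_permJ (n := n) (by omega) hp1.le
    refine ⟨⟨A, hA, hA.permanent_eq⟩, ?_, ?_, hfactor n p _ (upperBound_exponent_le hn hpn)⟩
    · rw [← hA.permanent_eq, max_le_iff, ← hJper]
      refine ⟨?_, hA.2 J hJ⟩
      simpa using hA.2 1 (one_mem_unitRowMatrices hp1.le)
    · rw [← hA.permanent_eq]
      exact (permanent_le_of_mem hp1.le hA.1).trans (exp_logBound_le_upperBound hp1 n)
  · refine ⟨Real.exp (Real.exp (1 / ε)), Real.exp_pos _, fun n hn p _ hεp _ => ?_⟩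
    refine hfactor n p _ ?_
    have hp0 : 0 < p := by linarith
    have h1 : (p - 1) / p ≤ 1 := by rw [div_le_one hp0]; linarith
    refine (mul_le_of_le_one_left (Real.exp_pos _).le h1).trans (Real.exp_le_exp.2 ?_)
    exact one_div_le_one_div_of_le hε (by linarith)
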